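/- Let $\mathsf{Pos}$ be the category whose objects are the non-empty partially ordered sets and whose morphisms are the monotone maps. A partially ordered set $X$ is connected if any two of its elements $x,y$ are joined by a finite sequence $x=z_0,z_1,\dots,z_n=y$ in $X$ in which, for each $i<n$, $z_i\le z_{i+1}$ or $z_{i+1}\le z_i$. A product diagram in a category is a pair of morphisms $A_1\xleftarrow{a_1}A\xrightarrow{a_2}A_2$ exhibiting $A$ as a product of $A_1$ and $A_2$, and a product projection of $A$ is a morphism out of $A$ that is one of the two morphisms of some product diagram. A morphism $f\colon A\to B$ of a category is called coextensive if (C1) for every product diagram $A_1\xleftarrow{a_1}A\xrightarrow{a_2}A_2$, the pushouts of $f$ along $a_1$ and along $a_2$ exist, and the resulting pushout squares $$\begin{array}{ccccc}A_1&\xleftarrow{a_1}&A&\xrightarrow{a_2}&A_2\\ \downarrow&&\downarrow{\scriptstyle f}&&\downarrow\\ B_1&\xleftarrow{b_1}&B&\xrightarrow{b_2}&B_2\end{array}$$ have as bottom row a product diagram $B_1\xleftarrow{b_1}B\xrightarrow{b_2}B_2$; and (C2) in every commutative diagram of the above shape in which both the top row and the bottom row are product diagrams, both squares are pushouts. **Proposition.**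 Let $X$ be a connected non-empty partially ordered set. Then every product projection $p\colon X\to A$ of $X$ in $\mathsf{Pos}$ is coextensive in $\mathsf{Pos}$. -/

import Mathlib

universe v u

namespace Coext

open CategoryTheory CategoryTheory.Limits

section General

variable {C : Type u} [Category.{v} C]

/-- `A₁ ⟵ A ⟶ A₂` is a product diagram: the cone `(p₁, p₂)` is a binary product of `A₁`, `A₂`. -/
def IsProductDiagram {A A₁ A₂ : C} (p₁ : A ⟶ A₁) (p₂ : A ⟶ A₂) : Prop :=
  Nonempty (IsLimit (BinaryFan.mk p₁ p₂))

/-- `p` is a product projection of its domain: it is one leg of some product diagram. -/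
def IsProductProjection {A A₁ : C} (p : A ⟶ A₁) : Prop :=
  ∃ (A₂ : C) (q : A ⟶ A₂), IsProductDiagram p q

/-- Condition (C1): `f : A ⟶ X` admits pushouts along the projections of any product diagram
`A₁ ⟵ A ⟶ A₂`, and the resulting pushouts form a product diagram `X₁ ⟵ X ⟶ X₂`. -/
def CoextensiveC1 {A X : C} (f : A ⟶ X) : Prop :=
  ∀ ⦃A₁ A₂ : C⦄ (a₁ : A ⟶ A₁) (a₂ : A ⟶ A₂), IsProductDiagram a₁ a₂ →
    HasPushout a₁ f ∧ HasPushout a₂ f ∧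
    ∀ ⦃X₁ X₂ : C⦄ (f₁ : A₁ ⟶ X₁) (f₂ : A₂ ⟶ X₂) (x₁ : X ⟶ X₁) (x₂ : X ⟶ X₂),
      IsPushout a₁ f f₁ x₁ → IsPushout a₂ f f₂ x₂ → IsProductDiagram x₁ x₂

/-- Condition (C2): in any commutative diagram from a product diagram `A₁ ⟵ A ⟶ A₂` to a product
diagram `X₁ ⟵ X ⟶ X₂` with middle vertical morphism `f`, both squares are pushouts. -/
def CoextensiveC2 {A X : C} (f : A ⟶ X) : Prop :=
  ∀ ⦃A₁ A₂ X₁ X₂ : C⦄ (a₁ : A ⟶ A₁) (a₂ : A ⟶ A₂) (x₁ : X ⟶ X₁) (x₂ : X ⟶ X₂)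
    (f₁ : A₁ ⟶ X₁) (f₂ : A₂ ⟶ X₂),
    a₁ ≫ f₁ = f ≫ x₁ → a₂ ≫ f₂ = f ≫ x₂ →
    IsProductDiagram a₁ a₂ → IsProductDiagram x₁ x₂ →
    IsPushout a₁ f f₁ x₁ ∧ IsPushout a₂ f f₂ x₂

/-- A morphism is coextensive if it satisfies (C1) and (C2). -/
def IsCoextensive {A X : C} (f : A ⟶ X) : Prop :=
  CoextensiveC1 f ∧ CoextensiveC2 f

end General

/-- The category of non-empty partially ordered sets and monotone maps, as a full subcategory of
the category of partially ordered sets. -/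
abbrev Pos : Type (u + 1) :=
  ObjectProperty.FullSubcategory (fun P : PartOrd.{u} => Nonempty P)

/-- Any two elements are joined by a finite zigzag of comparable elements. (Non-emptiness is not
included here; the objects of `Pos` are non-empty.) -/
def ZigzagConnected (P : Type u) [PartialOrder P] : Prop :=
  ∀ x y : P, Relation.ReflTransGen (fun a b : P => a ≤ b ∨ b ≤ a) x y

end Coext

/-! A product decomposition of `X` amounts to an operation `mix`, taking one component from each
argument. Connectedness lets a projection `p` respect the `mix` of every other decomposition, as an
order-preserving operation (`map_mix`, `map_mix_mono`). This operation therefore descends to `A` and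
splits it compatibly (`exists_isProductDiagram`). Over a surjection, any map of product diagrams
consists of pushouts (`isPushout_of_isProductDiagram`). This gives (C2), and it shows that the
splitting of `A` computes the pushouts in (C1). -/

namespace Coext

open CategoryTheory CategoryTheory.Limits

/-! ### Two decompositions of a poset -/

section Order

variable {X A B A₁ A₂ : Type*} [PartialOrder X] [PartialOrder A] [PartialOrder B]
  [PartialOrder A₁] [PartialOrder A₂]

/-- The monotone maps `p`, `q` exhibit `X` as the cartesian product of the two posets. -/
structure IsOrderProduct (p : X →o A) (q : X →o B) : Prop where
  le_of_le : ∀ ⦃x y⦄, p x ≤ p y → q x ≤ q y → x ≤ y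
  exists_eq : ∀ a b, ∃ x, p x = a ∧ q x = b

namespace IsOrderProduct

variable {p : X →o A} {q : X →o B} {a₁ : X →o A₁} {a₂ : X →o A₂}

theorem symm (h : IsOrderProduct p q) : IsOrderProduct q p where
  le_of_le _ _ hq hp := h.le_of_le hp hq
  exists_eq b a := (h.exists_eq a b).imp fun _ hx => hx.symm

theorem eq_of_eq (h : IsOrderProduct p q) {x y : X} (hp : p x = p y) (hq : q x = q y) : x = y :=
  le_antisymm (h.le_of_le hp.le hq.le) (h.le_of_le hp.ge hq.ge)

/-- In a square of a decomposition `(a₁, a₂)`, if the bottom edge is collapsed by a projection `p`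
of another decomposition, then so is the parallel top edge. The square is the sublattice generated
by two of its corners, and `p` preserves joins. -/
theorem eq_top_of_eq_bot (h : IsOrderProduct p q) (h' : IsOrderProduct a₁ a₂) {P Q R S : X}
    (hQS : a₁ Q = a₁ S) (hRS : a₂ R = a₂ S) (hQ : Q ≤ S) (hR : R ≤ S) (hP : P ≤ R)
    (e : p P = p Q) : p R = p S := by
  -- `w` is an upper bound of `Q` and `R` with `p w = p R`, and `S` is their join.
  obtain ⟨w, hw, hw'⟩ := h.exists_eq (p R) (q S)
  have hQw : Q ≤ w := h.le_of_le (by rw [← e, hw]; exact p.monotone hP)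
    (by rw [hw']; exact q.monotone hQ)
  have hRw : R ≤ w := h.le_of_le hw.ge (by rw [hw']; exact q.monotone hR)
  have hSw : S ≤ w := h'.le_of_le (hQS ▸ a₁.monotone hQw) (hRS ▸ a₂.monotone hRw)
  exact le_antisymm (p.monotone hR) (hw ▸ p.monotone hSw)

/-- The dual of `eq_top_of_eq_bot`. -/
theorem eq_bot_of_eq_top (h : IsOrderProduct p q) (h' : IsOrderProduct a₁ a₂) {P Q R S : X}
    (hRP : a₁ R = a₁ P) (hQP : a₂ Q = a₂ P) (hQ : P ≤ Q) (hR : P ≤ R) (hS : Q ≤ S)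
    (e : p R = p S) : p P = p Q := by
  obtain ⟨w, hw, hw'⟩ := h.exists_eq (p Q) (q P)
  have hQw : w ≤ Q := h.le_of_le hw.le (by rw [hw']; exact q.monotone hQ)
  have hRw : w ≤ R := h.le_of_le (by rw [e, hw]; exact p.monotone hS)
    (by rw [hw']; exact q.monotone hR)
  have hPw : w ≤ P := h'.le_of_le (hRP ▸ a₁.monotone hRw) (hQP ▸ a₂.monotone hQw)
  exact le_antisymm (p.monotone hQ) (hw ▸ p.monotone hPw)

/-- The point whose first component is that of `x` and whose second component is that of `y`. -/
noncomputable def mix (h : IsOrderProduct p q) (x y : X) : X :=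
  (h.exists_eq (p x) (q y)).choose

@[simp] theorem fst_mix (h : IsOrderProduct p q) (x y : X) : p (h.mix x y) = p x :=
  (h.exists_eq (p x) (q y)).choose_spec.1

@[simp] theorem snd_mix (h : IsOrderProduct p q) (x y : X) : q (h.mix x y) = q y :=
  (h.exists_eq (p x) (q y)).choose_spec.2

theorem mix_symm (h : IsOrderProduct p q) (x y : X) : h.symm.mix x y = h.mix y x :=
  h.eq_of_eq (by simp) (by simp)

@[simp] theorem mix_self (h : IsOrderProduct p q) (x : X) : h.mix x x = x :=
  h.eq_of_eq (by simp) (by simp)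

theorem mix_mono (h : IsOrderProduct p q) {x x' y y' : X} (hx : x ≤ x') (hy : y ≤ y') :
    h.mix x y ≤ h.mix x' y' :=
  h.le_of_le (by simpa using p.monotone hx) (by simpa using q.monotone hy)

end IsOrderProduct

end Order

/-! ### Strict refinement for connected posets -/

section Refinement

variable {X : Type u} {A B A₁ A₂ : Type*} [PartialOrder X] [PartialOrder A] [PartialOrder B]
  [PartialOrder A₁] [PartialOrder A₂]
  {p : X →o A} {q : X →o B} {a₁ : X →o A₁} {a₂ : X →o A₂}

namespace IsOrderProduct

/-- For `z = x` the values are squeezed between `p x` and `p y`. Each step of a zigzag from `x` to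
`z` then spans a square across which the collapse propagates, upwards or downwards. -/
theorem map_mix_left_of_le (hX : ZigzagConnected X) (h : IsOrderProduct p q)
    (h' : IsOrderProduct a₁ a₂) {x y : X} (hxy : x ≤ y) (e : p x = p y) (z : X) :
    p (h'.mix x z) = p (h'.mix y z) := by
  induction hX x z with
  | refl =>
    have h₁ : x ≤ h'.mix y x := (h'.mix_self x).ge.trans (h'.mix_mono hxy le_rfl)
    have h₂ : h'.mix y x ≤ y := (h'.mix_mono le_rfl hxy).trans (h'.mix_self y).le
    rw [mix_self]
    exact le_antisymm (p.monotone h₁) (e ▸ p.monotone h₂)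
  | tail _ hz ih =>
    rcases hz with hz | hz
    · exact h.eq_top_of_eq_bot h' (by simp) (by simp) (h'.mix_mono le_rfl hz)
        (h'.mix_mono hxy le_rfl) (h'.mix_mono le_rfl hz) ih
    · exact h.eq_bot_of_eq_top h' (by simp) (by simp) (h'.mix_mono hxy le_rfl)
        (h'.mix_mono le_rfl hz) (h'.mix_mono le_rfl hz) ih

/-- On a connected poset, the kernel of a product projection is compatible with every other
decomposition (the strict refinement property). -/
theorem map_mix_left (hX : ZigzagConnected X) (h : IsOrderProduct p q)
    (h' : IsOrderProduct a₁ a₂) {x y : X} (e : p x = p y) (z : X) :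
    p (h'.mix x z) = p (h'.mix y z) := by
  -- As `w` runs along a zigzag from `x` to `y`, `h.mix x w` stays in the fibre of `p` and reaches
  -- `y`, which reduces to comparable points.
  have key : ∀ w, p (h'.mix x z) = p (h'.mix (h.mix x w) z) := by
    intro w
    induction hX x w with
    | refl => rw [mix_self]
    | tail _ hw ih =>
      rw [ih]
      rcases hw with hw | hw
      · exact map_mix_left_of_le hX h h' (h.mix_mono le_rfl hw) (by simp) z
      · exact (map_mix_left_of_le hX h h' (h.mix_mono le_rfl hw) (by simp) z).symm
  have hy : h.mix x y = y := h.eq_of_eq (by simpa using e) (by simp)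
  simpa [hy] using key y

theorem map_mix (hX : ZigzagConnected X) (h : IsOrderProduct p q)
    (h' : IsOrderProduct a₁ a₂) {x y x' y' : X} (e : p x = p y) (e' : p x' = p y') :
    p (h'.mix x x') = p (h'.mix y y') := by
  rw [map_mix_left hX h h' e]
  have := map_mix_left hX h h'.symm e' y
  rwa [h'.mix_symm, h'.mix_symm] at this

theorem map_mix_mono (hX : ZigzagConnected X) (h : IsOrderProduct p q)
    (h' : IsOrderProduct a₁ a₂) {x y x' y' : X} (e : p x ≤ p y) (e' : p x' ≤ p y') :
    p (h'.mix x x') ≤ p (h'.mix y y') := by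
  have hx : x ≤ h.mix y x := h.le_of_le (by simpa using e) (by simp)
  have hx' : x' ≤ h.mix y' x' := h.le_of_le (by simpa using e') (by simp)
  exact (p.monotone (h'.mix_mono hx hx')).trans (map_mix hX h h' (by simp) (by simp)).le

end IsOrderProduct

end Refinement

/-! ### Product diagrams and pushouts in `Pos` -/

namespace Pos

/-- The underlying monotone map of a morphism of `Pos`. -/
abbrev toOrderHom {X Y : Pos.{u}} (f : X ⟶ Y) : X.obj →o Y.obj := f.hom.hom

/-- A monotone map as a morphism of `Pos`. -/
abbrev ofOrderHom {X Y : Pos.{u}} (f : X.obj →o Y.obj) : X ⟶ Y := ⟨PartOrd.ofHom f⟩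

theorem hom_ext {X Y : Pos.{u}} {f g : X ⟶ Y} (h : ∀ x, toOrderHom f x = toOrderHom g x) :
    f = g :=
  ObjectProperty.hom_ext _ (PartOrd.ext h)

/-- A non-empty poset as an object of `Pos`. -/
abbrev of (P : Type u) [PartialOrder P] [h : Nonempty P] : Pos.{u} := ⟨PartOrd.of P, h⟩

theorem comm_apply {X Y Z W : Pos.{u}} {f : X ⟶ Y} {g : Y ⟶ W} {f' : X ⟶ Z} {g' : Z ⟶ W}
    (h : f ≫ g = f' ≫ g') (x : X.obj) :
    toOrderHom g (toOrderHom f x) = toOrderHom g' (toOrderHom f' x) :=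
  congrArg (fun k => toOrderHom k x) h

theorem isProductDiagram_iff {X A B : Pos.{u}} (p : X ⟶ A) (q : X ⟶ B) :
    IsProductDiagram p q ↔ IsOrderProduct (toOrderHom p) (toOrderHom q) := by
  constructor
  · rintro ⟨h⟩
    have : Nonempty A.obj := A.property
    have : Nonempty B.obj := B.property
    let P : Pos.{u} := of (A.obj × B.obj)
    let π₁ : P ⟶ A := ofOrderHom OrderHom.fst
    let π₂ : P ⟶ B := ofOrderHom OrderHom.snd
    let r : X ⟶ P := ofOrderHom ((toOrderHom p).prod (toOrderHom q))
    obtain ⟨l, hl₁, hl₂⟩ := BinaryFan.IsLimit.lift' h π₁ π₂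
    -- Monotonicity of this retraction `l` makes `(p, q)` reflect the order.
    have hr : r ≫ l = 𝟙 X := by
      apply BinaryFan.IsLimit.hom_ext h
      · rw [Category.assoc, hl₁, Category.id_comp]; rfl
      · rw [Category.assoc, hl₂, Category.id_comp]; rfl
    have hr' (x : X.obj) : toOrderHom l (toOrderHom p x, toOrderHom q x) = x :=
      congrArg (fun k => toOrderHom k x) hr
    refine ⟨fun x y hp hq => ?_, fun a b => ⟨toOrderHom l (a, b), ?_, ?_⟩⟩
    · rw [← hr' x, ← hr' y]
      exact (toOrderHom l).monotone ⟨hp, hq⟩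
    · exact congrArg (fun k => toOrderHom k (a, b)) hl₁
    · exact congrArg (fun k => toOrderHom k (a, b)) hl₂
  · intro h
    choose m hm₁ hm₂ using h.exists_eq
    exact ⟨BinaryFan.IsLimit.mk _
      (fun {T} f g => ofOrderHom
        { toFun := fun t => m (toOrderHom f t) (toOrderHom g t)
          monotone' := fun s t hst => h.le_of_le
            (by rw [hm₁, hm₁]; exact (toOrderHom f).monotone hst)
            (by rw [hm₂, hm₂]; exact (toOrderHom g).monotone hst) })
      (fun f g => hom_ext fun t => hm₁ _ _)
      (fun f g => hom_ext fun t => hm₂ _ _)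
      (fun f g l hf hg => hom_ext fun t => h.eq_of_eq
        ((congrArg (fun k => toOrderHom k t) hf).trans (hm₁ _ _).symm)
        ((congrArg (fun k => toOrderHom k t) hg).trans (hm₂ _ _).symm))⟩

/-- A commutative square is a pushout if its right-hand side has a section `s` such that every
`a` is related to `s (g a)` by the image under `f` of a pair identified by `a₁`. -/
theorem isPushout_of_section {X A A₁ D : Pos.{u}} {a₁ : X ⟶ A₁} {f : X ⟶ A} {f₁ : A₁ ⟶ D}
    {g : A ⟶ D} (w : a₁ ≫ f₁ = f ≫ g) (hsurj : Function.Surjective (toOrderHom a₁))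
    (s : D ⟶ A) (hs : s ≫ g = 𝟙 D)
    (H : ∀ a, ∃ x x', toOrderHom a₁ x = toOrderHom a₁ x' ∧ toOrderHom f x = a ∧
      toOrderHom f x' = toOrderHom s (toOrderHom g a)) :
    IsPushout a₁ f f₁ g := by
  have key {T : Pos.{u}} (h : A₁ ⟶ T) (k : A ⟶ T) (e : a₁ ≫ h = f ≫ k) : g ≫ s ≫ k = k := by
    refine hom_ext fun a => ?_
    obtain ⟨x, x', hx, hxa, hxa'⟩ := H a
    change toOrderHom k (toOrderHom s (toOrderHom g a)) = _
    rw [← hxa', ← comm_apply e, ← hx, comm_apply e, hxa]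
  refine ⟨⟨w⟩, ⟨PushoutCocone.IsColimit.mk w (fun c => s ≫ c.inr) (fun c => ?_)
    (fun c => key c.inl c.inr c.condition) (fun c m _ hm => ?_)⟩⟩
  · refine hom_ext fun u => ?_
    obtain ⟨x, rfl⟩ := hsurj u
    have e : a₁ ≫ f₁ ≫ s ≫ c.inr = a₁ ≫ c.inl := by
      rw [reassoc_of% w, key c.inl c.inr c.condition, c.condition]
    exact congrArg (fun k => toOrderHom k x) e
  · rw [← hm, reassoc_of% hs]

theorem surjective_fst {X A B : Pos.{u}} {p : X ⟶ A} {q : X ⟶ B} (h : IsProductDiagram p q) :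
    Function.Surjective (toOrderHom p) := fun a =>
  ((((isProductDiagram_iff p q).1 h).exists_eq a B.property.some).imp fun _ hx => hx.1)

/-- Freezing the second coordinate at that of `p z` gives a section of `x₁`. The pair `x`, `ha'.mix
x z` upstairs witnesses the required relation. -/
theorem isPushout_of_isProductDiagram {X A A₁ A₂ X₁ X₂ : Pos.{u}} {p : X ⟶ A}
    (hp : Function.Surjective (toOrderHom p)) {a₁ : X ⟶ A₁} {a₂ : X ⟶ A₂} {x₁ : A ⟶ X₁}
    {x₂ : A ⟶ X₂} {f₁ : A₁ ⟶ X₁} {f₂ : A₂ ⟶ X₂} (w₁ : a₁ ≫ f₁ = p ≫ x₁) (w₂ : a₂ ≫ f₂ = p ≫ x₂)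
    (ha : IsProductDiagram a₁ a₂) (hx : IsProductDiagram x₁ x₂) : IsPushout a₁ p f₁ x₁ := by
  have ha' := (isProductDiagram_iff _ _).1 ha
  have hx' := (isProductDiagram_iff _ _).1 hx
  obtain ⟨z⟩ := X.property
  choose m hm₁ hm₂ using fun u => hx'.exists_eq u (toOrderHom x₂ (toOrderHom p z))
  refine isPushout_of_section w₁ (surjective_fst ha) (ofOrderHom
    { toFun := m
      monotone' := fun u v huv => hx'.le_of_le (by rwa [hm₁, hm₁]) (by rw [hm₂, hm₂]) })
    (hom_ext hm₁) fun a => ?_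
  obtain ⟨x, rfl⟩ := hp a
  refine ⟨x, ha'.mix x z, by simp, rfl, hx'.eq_of_eq ?_ ?_⟩
  · refine Eq.trans ?_ (hm₁ _).symm
    rw [← comm_apply w₁, ha'.fst_mix, comm_apply w₁]
  · refine Eq.trans ?_ (hm₂ _).symm
    rw [← comm_apply w₂, ha'.snd_mix, comm_apply w₂]

/-- For a connected poset `X`, a projection `p` and a product diagram `(a₁, a₂)` of `X` fit into
a pair of commutative squares with bottom row a product diagram. -/
theorem exists_isProductDiagram {X A A₁ A₂ : Pos.{u}} (hX : ZigzagConnected X.obj) {p : X ⟶ A}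
    (hp : IsProductProjection p) {a₁ : X ⟶ A₁} {a₂ : X ⟶ A₂} (ha : IsProductDiagram a₁ a₂) :
    ∃ (D₁ D₂ : Pos.{u}) (f₁ : A₁ ⟶ D₁) (f₂ : A₂ ⟶ D₂) (x₁ : A ⟶ D₁) (x₂ : A ⟶ D₂),
      a₁ ≫ f₁ = p ≫ x₁ ∧ a₂ ≫ f₂ = p ≫ x₂ ∧ IsProductDiagram x₁ x₂ := by
  obtain ⟨B, q, hpq⟩ := hp
  have h := (isProductDiagram_iff _ _).1 hpq
  have h' := (isProductDiagram_iff _ _).1 ha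
  obtain ⟨z⟩ := X.property
  choose σ hσ using surjective_fst hpq
  choose m hm₁ hm₂ using h'.exists_eq
  have mono {x y x' y' : X.obj} := h.map_mix_mono hX h' (x := x) (y := y) (x' := x') (y' := y')
  have cong {x y x' y' : X.obj} := h.map_mix hX h' (x := x) (y := y) (x' := x') (y' := y')
  -- The descended `mix`, a monotone rectangular band on `A`. The factors of `A` are its two slices
  -- through the base point `o`.
  let g : A.obj → A.obj → A.obj := fun a b => toOrderHom p (h'.mix (σ a) (σ b))
  have hg (x y : X.obj) : g (toOrderHom p x) (toOrderHom p y) = toOrderHom p (h'.mix x y) :=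
    cong (hσ _) (hσ _)
  have gmono {a b a' b' : A.obj} (e : a ≤ b) (e' : a' ≤ b') : g a a' ≤ g b b' :=
    mono (by rwa [hσ, hσ]) (by rwa [hσ, hσ])
  have gself (a : A.obj) : g a a = a := by simp [g, hσ]
  have gleft (a b c : A.obj) : g (g a b) c = g a c :=
    (cong (hσ _) rfl).trans (congrArg _ (h'.eq_of_eq (by simp) (by simp)))
  have gright (a b c : A.obj) : g a (g b c) = g a c :=
    (cong rfl (hσ _)).trans (congrArg _ (h'.eq_of_eq (by simp) (by simp)))
  let o := toOrderHom p z
  have : Nonempty {d : A.obj // g d o = d} := ⟨⟨o, gself o⟩⟩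
  have : Nonempty {d : A.obj // g o d = d} := ⟨⟨o, gself o⟩⟩
  refine ⟨of {d : A.obj // g d o = d}, of {d : A.obj // g o d = d},
    ofOrderHom ⟨fun u => ⟨toOrderHom p (m u (toOrderHom a₂ z)), ?_⟩, fun u v huv => ?_⟩,
    ofOrderHom ⟨fun u => ⟨toOrderHom p (m (toOrderHom a₁ z) u), ?_⟩, fun u v huv => ?_⟩,
    ofOrderHom ⟨fun a => ⟨g a o, gleft _ _ _⟩, fun a b hab => gmono hab le_rfl⟩,
    ofOrderHom ⟨fun a => ⟨g o a, gright _ _ _⟩, fun a b hab => gmono le_rfl hab⟩,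
    hom_ext fun x => Subtype.ext ?_, hom_ext fun x => Subtype.ext ?_,
    (isProductDiagram_iff _ _).2 ⟨fun a b h₁ h₂ => ?_, ?_⟩⟩
  · rw [hg]
    exact congrArg _ (h'.eq_of_eq (by simp) (by simp [hm₂]))
  · exact (toOrderHom p).monotone
      (h'.le_of_le (by rwa [hm₁, hm₁]) (by rw [hm₂, hm₂]))
  · rw [hg]
    exact congrArg _ (h'.eq_of_eq (by simp [hm₁]) (by simp))
  · exact (toOrderHom p).monotone
      (h'.le_of_le (by rw [hm₁, hm₁]) (by rwa [hm₂, hm₂]))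
  · refine Eq.trans ?_ (hg x z).symm
    exact congrArg _ (h'.eq_of_eq ((hm₁ _ _).trans (h'.fst_mix x z).symm)
      ((hm₂ _ _).trans (h'.snd_mix x z).symm))
  · refine Eq.trans ?_ (hg z x).symm
    exact congrArg _ (h'.eq_of_eq ((hm₁ _ _).trans (h'.fst_mix z x).symm)
      ((hm₂ _ _).trans (h'.snd_mix z x).symm))
  -- Each `a` is recovered from its components as `g (g a o) (g o a)`.
  · have e : g (g a o) (g o a) ≤ g (g b o) (g o b) := gmono h₁ h₂
    simpa [gleft, gright, gself] using e
  · rintro ⟨d, hd⟩ ⟨e, he⟩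
    exact ⟨g d e, Subtype.ext ((gleft d e o).trans hd), Subtype.ext ((gright o d e).trans he)⟩

end Pos

theorem IsProductDiagram.comp_iso {C : Type u} [Category.{v} C] {A A₁ A₂ B₁ B₂ : C}
    {a₁ : A ⟶ A₁} {a₂ : A ⟶ A₂} (h : IsProductDiagram a₁ a₂) (e₁ : A₁ ≅ B₁) (e₂ : A₂ ≅ B₂) :
    IsProductDiagram (a₁ ≫ e₁.hom) (a₂ ≫ e₂.hom) := by
  obtain ⟨h⟩ := h
  refine ⟨BinaryFan.IsLimit.mk _
    (fun f g => h.lift (BinaryFan.mk (f ≫ e₁.inv) (g ≫ e₂.inv)))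
    (fun f g => ?_) (fun f g => ?_) (fun f g l hf hg => ?_)⟩
  · exact (Category.assoc _ _ _).symm.trans
      ((Iso.eq_comp_inv _).1 (h.fac (BinaryFan.mk (f ≫ e₁.inv) (g ≫ e₂.inv)) ⟨.left⟩))
  · exact (Category.assoc _ _ _).symm.trans
      ((Iso.eq_comp_inv _).1 (h.fac (BinaryFan.mk (f ≫ e₁.inv) (g ≫ e₂.inv)) ⟨.right⟩))
  · apply BinaryFan.IsLimit.hom_ext h
    · refine Eq.trans ?_ (h.fac (BinaryFan.mk (f ≫ e₁.inv) (g ≫ e₂.inv)) ⟨.left⟩).symm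
      exact (Iso.eq_comp_inv _).2 ((Category.assoc _ _ _).trans hf)
    · refine Eq.trans ?_ (h.fac (BinaryFan.mk (f ≫ e₁.inv) (g ≫ e₂.inv)) ⟨.right⟩).symm
      exact (Iso.eq_comp_inv _).2 ((Category.assoc _ _ _).trans hg)

theorem IsProductDiagram.symm {C : Type u} [Category.{v} C] {A A₁ A₂ : C}
    {a₁ : A ⟶ A₁} {a₂ : A ⟶ A₂} (h : IsProductDiagram a₁ a₂) : IsProductDiagram a₂ a₁ :=
  h.map BinaryFan.isLimitFlip

end Coext

theorem mainTheorem11 (X A : Coext.Pos.{u}) (hX : Coext.ZigzagConnected X.obj)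
    (p : X ⟶ A) (hp : Coext.IsProductProjection p) : Coext.IsCoextensive p := by
  have hsurj : Function.Surjective (Coext.Pos.toOrderHom p) := by
    obtain ⟨B, q, hpq⟩ := hp
    exact Coext.Pos.surjective_fst hpq
  refine ⟨fun A₁ A₂ a₁ a₂ ha => ?_, fun A₁ A₂ X₁ X₂ a₁ a₂ x₁ x₂ f₁ f₂ w₁ w₂ ha hx =>
    ⟨Coext.Pos.isPushout_of_isProductDiagram hsurj w₁ w₂ ha hx,
      Coext.Pos.isPushout_of_isProductDiagram hsurj w₂ w₁ ha.symm hx.symm⟩⟩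
  obtain ⟨D₁, D₂, f₁, f₂, x₁, x₂, w₁, w₂, hx⟩ := Coext.Pos.exists_isProductDiagram hX hp ha
  have h₁ := Coext.Pos.isPushout_of_isProductDiagram hsurj w₁ w₂ ha hx
  have h₂ := Coext.Pos.isPushout_of_isProductDiagram hsurj w₂ w₁ ha.symm hx.symm
  refine ⟨h₁.hasPushout, h₂.hasPushout, fun Y₁ Y₂ g₁ g₂ y₁ y₂ k₁ k₂ => ?_⟩
  -- Arbitrary pushouts agree with the constructed ones up to isomorphism.
  simpa using hx.comp_iso (h₁.isoIsPushout _ _ k₁) (h₂.isoIsPushout _ _ k₂)
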